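/- In the TwoChoice process, balls are allocated sequentially into $n$ initially empty bins; for each ball, two bins are sampled independently and uniformly at random (with replacement), and the ball is placed into the lesser loaded of the two, ties being broken by a fair coin. Let $x_i^{(m)}$ be the load of bin $i$ after $m$ balls have been allocated, and let \[ \mathrm{Gap}(m) := \max_{1 \le i \le n} x_i^{(m)} - \frac{m}{n}. \] There is an absolute constant $C > 0$ such that for every $n \ge 3$ and every $m \ge 1$, \[ \Pr\left[\, \mathrm{Gap}(m) \le C \log\log n \,\right] \ge 1 - n^{-3}, \] where $\log$ denotes the natural logarithm. -/

import Mathlib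

namespace TwoChoice

noncomputable section

/-- The bin receiving the next ball when the load vector is `x` and the two sampled bins are `i`
and `j`: the lesser loaded of the two, a tie being broken by a fair coin. -/
def choose {n : ℕ} (x : Fin n → ℕ) (i j : Fin n) : PMF (Fin n) :=
  if x i < x j then PMF.pure i
  else if x j < x i then PMF.pure j
  else (PMF.uniformOfFintype Bool).map (fun b => if b then i else j)

/-- Put one more ball into bin `i`. -/
def addBall {n : ℕ} (x : Fin n → ℕ) (i : Fin n) : Fin n → ℕ :=
  Function.update x i (x i + 1)

/-- One step of the process from the load vector `x`: sample two bins independently and uniformly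
at random (with replacement) and put a ball into the lesser loaded one. -/
def step {n : ℕ} [NeZero n] (x : Fin n → ℕ) : PMF (Fin n → ℕ) :=
  (PMF.uniformOfFintype (Fin n)).bind fun i =>
    (PMF.uniformOfFintype (Fin n)).bind fun j =>
      (choose x i j).map (addBall x)

/-- The law of the load vector after `t` balls have been allocated sequentially into `n` initially
empty bins (the law at time `t` of the Markov chain with transition `step` started at `0`). -/
def loadLaw (n : ℕ) [NeZero n] : ℕ → PMF (Fin n → ℕ)
  | 0 => PMF.pure 0
  | t + 1 => (loadLaw n t).bind step

/-- The gap of the load vector `x` at time `t`: maximum load minus average load `t / n`. -/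
def gap {n : ℕ} (t : ℕ) (x : Fin n → ℕ) : ℝ :=
  ((Finset.univ.sup x : ℕ) : ℝ) - (t : ℝ) / (n : ℝ)

end

end TwoChoice

/-!
The process is studied through its transition operator on functions of the load vector. The proof
follows the scheme of a potential function argument and one round of layered induction.

*Potential.* Let `z i` be the load of bin `i` minus the average load. The ball goes to the lesser
loaded of two samples, so for an increasing function `φ` the expected value of `φ` at the chosen bin
is the mean of `φ (z i)` minus half of its mean difference `|φ (z i) - φ (z j)|`. For
`φ = sinh (· / 24)` this makes the first order drift of the potential `∑ i, cosh (z i / 24)` a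
negative multiple of the mean difference of `sinh (z i / 24)`. As the `z i` have mean zero,
convexity of `sinh` on the positive half line bounds the mean difference below by half the mean of
`|sinh (z i / 24)|` (`sum_abs_sinh_le_sum_sum_abs_sub`), and this dominates the second order terms.
Hence the expected potential contracts at rate `1 - 1 / (192 n)` down to `2 n`
(`iterate_transition_potential_le`). This alone gives a gap of order `log n`, and settles small `n`.

*Concentration.* If one ball is added to the initial load vector, the two processes can be coupled
so that the final load vectors still differ by one ball (`HasUnitIncrements.transition`). So the
number of bins with load at least `h` is a function whose conditional expectations have bounded
differences, and it obeys an exponential tail bound (`prob_lt_le_exp`) over `n * polylog n` steps.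

*Layers.* Start `n L` steps before time `m`, with `L` of order `log n`, or with empty bins if
`m ≤ n L`. With high probability the potential is then polynomial in `n`, so that every load is at
most the average load `m / n` at time `m`, and the expected potential at time `m` is at most `3 n`. By concentration, at time `m`
at most `n / O(log n)` bins have load at least `m / n + O(log log n)`. All balls above these heights
arrive in the last `n L` steps, and the number of bins with load at least `h` only grows with time;
if it is at most `b` in the end, each ball goes above height `h` with probability at most
`(b / n) ^ 2` (`prob_layer_le`). So the fraction of bins, suitably scaled, is squared from one
height to the next until at most `5 log n` bins are left after `O(log log n)` layers
(`prob_layerBound_lt_aboveCount_le`). Above the next height there are at most four balls.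
-/

namespace TwoChoice

open scoped ENNReal

noncomputable section

/-! ### The transition operator and the law of the process -/

/-- The mean of `g` at the bin chosen between the sampled bins `i` and `j`, over the coin that
breaks ties. -/
def pick {n : ℕ} (x : Fin n → ℕ) (i j : Fin n) (g : Fin n → ℝ) : ℝ :=
  if x i < x j then g i else if x j < x i then g j else (g i + g j) / 2

/-- The mean of `g` at the bin that receives the next ball, when the load vector is `x`. -/
def binMean {n : ℕ} (x : Fin n → ℕ) (g : Fin n → ℝ) : ℝ :=
  (∑ i, ∑ j, pick x i j g) / (n : ℝ) ^ 2

/-- The transition operator of the process: `transition F x` is the mean of `F` after one step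
from `x`. -/
def transition {n : ℕ} (F : (Fin n → ℕ) → ℝ) (x : Fin n → ℕ) : ℝ :=
  binMean x fun k => F (addBall x k)

section Law

lemma tsum_bind_mul {α β : Type*} (p : PMF α) (q : α → PMF β) (g : β → ℝ≥0∞) :
    ∑' b, (p.bind q) b * g b = ∑' a, p a * ∑' b, q a b * g b := by
  simp only [PMF.bind_apply, ← ENNReal.tsum_mul_right, ← ENNReal.tsum_mul_left]
  rw [ENNReal.tsum_comm]
  simp only [mul_assoc]

lemma tsum_pure_mul {β : Type*} (b₀ : β) (g : β → ℝ≥0∞) :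
    ∑' b, (PMF.pure b₀) b * g b = g b₀ := by
  rw [tsum_eq_single b₀]
  · simp
  · intro b hb
    simp [hb]

lemma tsum_map_mul {α β : Type*} (p : PMF α) (h : α → β) (g : β → ℝ≥0∞) :
    ∑' b, (p.map h) b * g b = ∑' a, p a * g (h a) := by
  rw [PMF.map, tsum_bind_mul]
  simp only [Function.comp_apply, tsum_pure_mul]

lemma tsum_choose_mul {n : ℕ} (x : Fin n → ℕ) (i j : Fin n) (g : Fin n → ℝ) (hg : ∀ k, 0 ≤ g k) :
    ∑' k, choose x i j k * ENNReal.ofReal (g k) = ENNReal.ofReal (pick x i j g) := by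
  unfold choose pick
  split_ifs
  · rw [tsum_pure_mul]
  · rw [tsum_pure_mul]
  · rw [tsum_map_mul, tsum_fintype]
    simp only [PMF.uniformOfFintype_apply, Fintype.univ_bool, Fintype.card_bool,
      Finset.sum_insert (show true ∉ ({false} : Finset Bool) by decide), Finset.sum_singleton]
    rw [← mul_add]
    simp only [if_true, Bool.false_eq_true, if_false]
    rw [← ENNReal.ofReal_add (hg i) (hg j), ENNReal.ofReal_div_of_pos two_pos,
      ENNReal.div_eq_inv_mul]
    simp

lemma pick_nonneg {n : ℕ} (x : Fin n → ℕ) (i j : Fin n) {g : Fin n → ℝ} (hg : ∀ k, 0 ≤ g k) :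
    0 ≤ pick x i j g := by
  have := hg i
  have := hg j
  unfold pick
  split_ifs <;> linarith

lemma tsum_step_mul {n : ℕ} [NeZero n] (x : Fin n → ℕ) (F : (Fin n → ℕ) → ℝ) (hF : ∀ y, 0 ≤ F y) :
    ∑' y, step x y * ENNReal.ofReal (F y) = ENNReal.ofReal (transition F x) := by
  have hn : (0 : ℝ) < n := by exact_mod_cast Nat.pos_of_ne_zero (NeZero.ne n)
  have hp := fun i j => pick_nonneg x i j (g := fun k => F (addBall x k)) fun k => hF _
  simp only [step, tsum_bind_mul, tsum_map_mul]
  simp only [tsum_choose_mul x _ _ (fun k => F (addBall x k)) fun k => hF _]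
  simp only [tsum_fintype, PMF.uniformOfFintype_apply, Fintype.card_fin, ← Finset.mul_sum]
  simp only [← ENNReal.ofReal_sum_of_nonneg fun j _ => hp _ j]
  rw [← ENNReal.ofReal_sum_of_nonneg fun i _ => Finset.sum_nonneg fun j _ => hp i j]
  rw [transition, binMean, ENNReal.ofReal_div_of_pos (by positivity), ENNReal.div_eq_inv_mul,
    ENNReal.ofReal_pow hn.le, ENNReal.ofReal_natCast, pow_two, ENNReal.mul_inv (by simp) (by simp),
    mul_assoc]

lemma transition_nonneg {n : ℕ} {F : (Fin n → ℕ) → ℝ} (hF : ∀ y, 0 ≤ F y) (x : Fin n → ℕ) :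
    0 ≤ transition F x :=
  div_nonneg (Finset.sum_nonneg fun _ _ => Finset.sum_nonneg fun _ _ =>
    pick_nonneg x _ _ fun _ => hF _) (by positivity)

lemma tsum_loadLaw_mul {n : ℕ} [NeZero n] (t : ℕ) (F : (Fin n → ℕ) → ℝ) (hF : ∀ y, 0 ≤ F y) :
    ∑' y, loadLaw n t y * ENNReal.ofReal (F y) = ENNReal.ofReal (transition^[t] F 0) := by
  induction t generalizing F with
  | zero => simp only [loadLaw, tsum_pure_mul, Function.iterate_zero, id]
  | succ t ih =>
    simp only [loadLaw, tsum_bind_mul, tsum_step_mul _ F hF, Function.iterate_succ_apply]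
    exact ih _ (transition_nonneg hF)

lemma iterate_transition_nonneg {n : ℕ} (t : ℕ) {F : (Fin n → ℕ) → ℝ} (hF : ∀ y, 0 ≤ F y)
    (x : Fin n → ℕ) : 0 ≤ transition^[t] F x := by
  induction t generalizing F with
  | zero => exact hF x
  | succ t ih => exact ih (transition_nonneg hF)

/-- Probabilities under the law at time `t` are values of the iterated transition operator. -/
lemma loadLaw_real_apply {n : ℕ} [NeZero n] (t : ℕ) (A : Set (Fin n → ℕ)) :
    (loadLaw n t).toMeasure.real A = transition^[t] (A.indicator 1) 0 := by
  have h0 : ∀ y, 0 ≤ A.indicator (1 : (Fin n → ℕ) → ℝ) y :=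
    Set.indicator_nonneg fun _ _ => zero_le_one
  have h := tsum_loadLaw_mul t (A.indicator 1) h0
  rw [MeasureTheory.measureReal_def, PMF.toMeasure_apply (hs := (Set.to_countable A).measurableSet)]
  rw [← ENNReal.toReal_ofReal (iterate_transition_nonneg t h0 0), ← h]
  congr 2
  ext y
  by_cases hy : y ∈ A <;> simp [hy]

end Law

/-! ### Linearity and monotonicity of the transition operator -/

section Linear

variable {n : ℕ}

lemma pick_mono (x : Fin n → ℕ) (i j : Fin n) {g g' : Fin n → ℝ} (h : ∀ k, g k ≤ g' k) :
    pick x i j g ≤ pick x i j g' := by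
  have := h i
  have := h j
  unfold pick
  split_ifs <;> linarith

lemma pick_add (x : Fin n → ℕ) (i j : Fin n) (g g' : Fin n → ℝ) :
    pick x i j (fun k => g k + g' k) = pick x i j g + pick x i j g' := by
  unfold pick
  split_ifs <;> ring

lemma pick_const_mul (x : Fin n → ℕ) (i j : Fin n) (c : ℝ) (g : Fin n → ℝ) :
    pick x i j (fun k => c * g k) = c * pick x i j g := by
  unfold pick
  split_ifs <;> ring

lemma pick_const (x : Fin n → ℕ) (i j : Fin n) (c : ℝ) : pick x i j (fun _ => c) = c := by
  unfold pick
  split_ifs <;> ring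

lemma binMean_mono (x : Fin n → ℕ) {g g' : Fin n → ℝ} (h : ∀ k, g k ≤ g' k) :
    binMean x g ≤ binMean x g' := by
  unfold binMean
  gcongr
  exact pick_mono x _ _ h

lemma binMean_add (x : Fin n → ℕ) (g g' : Fin n → ℝ) :
    binMean x (fun k => g k + g' k) = binMean x g + binMean x g' := by
  simp only [binMean, pick_add, Finset.sum_add_distrib, add_div]

lemma binMean_const_mul (x : Fin n → ℕ) (c : ℝ) (g : Fin n → ℝ) :
    binMean x (fun k => c * g k) = c * binMean x g := by
  simp only [binMean, pick_const_mul, ← Finset.mul_sum, mul_div_assoc]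

lemma binMean_const [NeZero n] (x : Fin n → ℕ) (c : ℝ) : binMean x (fun _ => c) = c := by
  have hn : (n : ℝ) ≠ 0 := by exact_mod_cast NeZero.ne n
  simp only [binMean, pick_const, Finset.sum_const, Finset.card_univ, Fintype.card_fin,
    nsmul_eq_mul]
  field_simp

/-- The chosen bin is one of two uniform samples, so that its law is at most twice uniform. -/
lemma binMean_le_two_mul [NeZero n] (x : Fin n → ℕ) {g : Fin n → ℝ} (hg : ∀ k, 0 ≤ g k) :
    binMean x g ≤ 2 * (∑ i, g i) / n := by
  have hn : (0 : ℝ) < n := by exact_mod_cast Nat.pos_of_ne_zero (NeZero.ne n)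
  have h : ∑ i, ∑ j, pick x i j g ≤ ∑ i, ∑ j, (g i + g j) := by
    gcongr with i _ j _
    have := hg i
    have := hg j
    unfold pick
    split_ifs <;> linarith
  simp only [Finset.sum_add_distrib, Finset.sum_const, Finset.card_univ, Fintype.card_fin,
    nsmul_eq_mul, ← Finset.mul_sum] at h
  rw [binMean, div_le_div_iff₀ (by positivity) hn]
  calc _ ≤ (n * ∑ i, g i + n * ∑ i, g i) * n := by gcongr
    _ = _ := by ring

/-- For an increasing function of the load, the chosen value is the smaller of the two sampled
values. -/
lemma binMean_of_monotone [NeZero n] (x : Fin n → ℕ) {φ : ℕ → ℝ} (hφ : Monotone φ) :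
    binMean x (fun k => φ (x k)) =
      (∑ i, φ (x i)) / n - (∑ i, ∑ j, |φ (x i) - φ (x j)|) / (2 * (n : ℝ) ^ 2) := by
  have hn : (0 : ℝ) < n := by exact_mod_cast Nat.pos_of_ne_zero (NeZero.ne n)
  have h : ∀ i j, pick x i j (fun k => φ (x k)) =
      (1 / 2) * φ (x i) + (1 / 2) * φ (x j) - (1 / 2) * |φ (x i) - φ (x j)| := by
    intro i j
    simp only [pick]
    split_ifs with h1 h2
    · rw [abs_of_nonpos (sub_nonpos.2 (hφ h1.le))]; ring
    · rw [abs_of_nonneg (sub_nonneg.2 (hφ h2.le))]; ring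
    · rw [le_antisymm (not_lt.1 h2) (not_lt.1 h1), sub_self, abs_zero]; ring
  simp only [binMean, h, Finset.sum_add_distrib, Finset.sum_sub_distrib, ← Finset.mul_sum,
    Finset.sum_const, Finset.card_univ, Fintype.card_fin, nsmul_eq_mul]
  field_simp
  ring

lemma transition_add (F F' : (Fin n → ℕ) → ℝ) (x : Fin n → ℕ) :
    transition (fun y => F y + F' y) x = transition F x + transition F' x :=
  binMean_add x _ _

lemma iterate_transition_add (t : ℕ) (F F' : (Fin n → ℕ) → ℝ) (x : Fin n → ℕ) :
    transition^[t] (fun y => F y + F' y) x = transition^[t] F x + transition^[t] F' x := by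
  induction t generalizing F F' with
  | zero => rfl
  | succ t ih =>
    simp only [Function.iterate_succ_apply, ← ih]
    exact congrArg (fun f => transition^[t] f x) (funext fun y => transition_add F F' y)

lemma iterate_transition_const_mul (t : ℕ) (c : ℝ) (F : (Fin n → ℕ) → ℝ) (x : Fin n → ℕ) :
    transition^[t] (fun y => c * F y) x = c * transition^[t] F x := by
  induction t generalizing F with
  | zero => rfl
  | succ t ih =>
    simp only [Function.iterate_succ_apply, ← ih]
    exact congrArg (fun f => transition^[t] f x) (funext fun y => binMean_const_mul y _ _)

lemma iterate_transition_const [NeZero n] (t : ℕ) (c : ℝ) (x : Fin n → ℕ) :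
    transition^[t] (fun _ => c) x = c := by
  induction t with
  | zero => rfl
  | succ t ih =>
    rw [Function.iterate_succ_apply]
    conv_rhs => rw [← ih]
    exact congrArg (fun f => transition^[t] f x) (funext fun y => binMean_const y _)

lemma sum_addBall (x : Fin n → ℕ) (k : Fin n) : ∑ i, addBall x k i = ∑ i, x i + 1 := by
  rw [addBall, Finset.sum_update_of_mem (Finset.mem_univ k),
    ← Finset.add_sum_erase _ x (Finset.mem_univ k), Finset.erase_eq]
  ring

/-- Monotonicity of the iterated transition operator; only load vectors with the right number of
balls matter. -/
lemma iterate_transition_mono (t : ℕ) {F F' : (Fin n → ℕ) → ℝ} (x : Fin n → ℕ)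
    (h : ∀ y, ∑ i, y i = ∑ i, x i + t → F y ≤ F' y) :
    transition^[t] F x ≤ transition^[t] F' x := by
  induction t generalizing x with
  | zero => exact h x rfl
  | succ t ih =>
    simp only [Function.iterate_succ_apply']
    exact binMean_mono x fun k => ih _ fun y hy => h y (by rw [hy, sum_addBall]; ring)

end Linear

/-! ### Convexity of the hyperbolic sine -/

lemma mul_sinh_le_mul_sinh {a w : ℝ} (hw : 0 ≤ w) (hwa : w ≤ a) :
    a * Real.sinh w ≤ w * Real.sinh a := by
  rcases hw.eq_or_lt with rfl | hw'
  · simp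
  have hconv : ConvexOn ℝ (Set.Ici (0 : ℝ)) Real.sinh := by
    refine convexOn_of_deriv2_nonneg (convex_Ici 0) Real.continuous_sinh.continuousOn
      Real.differentiable_sinh.differentiableOn ?_ ?_
    · rw [Real.deriv_sinh]
      exact Real.differentiable_cosh.differentiableOn
    · intro x hx
      rw [interior_Ici] at hx
      simp only [Function.iterate_succ, Function.iterate_zero, Function.comp_apply, id,
        Real.deriv_sinh, Real.deriv_cosh]
      exact Real.sinh_nonneg_iff.2 hx.le
  have ha : 0 < a := hw'.trans_le hwa
  have h := hconv.2 (Set.mem_Ici.2 le_rfl) (Set.mem_Ici.2 ha.le)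
    (sub_nonneg.2 ((div_le_one ha).2 hwa)) (div_nonneg hw ha.le) (sub_add_cancel _ _)
  simp only [smul_eq_mul, mul_zero, zero_add, Real.sinh_zero, div_mul_cancel₀ _ ha.ne'] at h
  calc a * Real.sinh w ≤ a * (w / a * Real.sinh a) := by gcongr
    _ = _ := by field_simp

/-- A linear lower bound for the part of `sinh` below the level `sinh a`. -/
lemma mul_sub_le_max_sinh_sub {a : ℝ} (ha : 0 < a) (w : ℝ) :
    Real.sinh a * (a - w) ≤ 2 * a * max (Real.sinh a - Real.sinh w) 0 := by
  have hs : 0 < Real.sinh a := Real.sinh_pos_iff.2 ha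
  rcases le_total a w with h | h
  · have : 0 ≤ max (Real.sinh a - Real.sinh w) 0 := le_max_right _ _
    have h2 : Real.sinh a * (a - w) ≤ 0 := mul_nonpos_of_nonneg_of_nonpos hs.le (by linarith)
    have h3 : 0 ≤ 2 * a * max (Real.sinh a - Real.sinh w) 0 := by positivity
    linarith
  · suffices H : Real.sinh a * (a - w) ≤ 2 * a * (Real.sinh a - Real.sinh w) from
      H.trans (by gcongr; exact le_max_left _ _)
    rcases le_total 0 w with h0 | h0
    · have := mul_sinh_le_mul_sinh h0 h
      nlinarith
    · have hw : Real.sinh w = -Real.sinh (-w) := by rw [Real.sinh_neg, neg_neg]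
      have h1 : 0 ≤ Real.sinh (-w) := Real.sinh_nonneg_iff.2 (by linarith)
      rcases le_total (-w) a with h2 | h2
      · rw [hw]
        nlinarith
      · have := mul_sinh_le_mul_sinh ha.le h2
        rw [hw]
        nlinarith

variable {n : ℕ}

/-- If `w` has mean zero, then the mean absolute deviation of `sinh ∘ w` is at least the mean of
`sinh ∘ w`: the values of `w` below the level `arsinh m` compensate those above it. -/
lemma sum_sinh_le_sum_abs_sub (w : Fin n → ℝ) (hw : ∑ i, w i = 0) (m : ℝ)
    (hm : ∑ i, Real.sinh (w i) = n * m) :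
    n * m ≤ ∑ i, |Real.sinh (w i) - m| := by
  rcases le_or_gt m 0 with h0 | h0
  · exact (mul_nonpos_of_nonneg_of_nonpos n.cast_nonneg h0).trans
      (Finset.sum_nonneg fun _ _ => abs_nonneg _)
  obtain ⟨a, rfl⟩ := Real.sinh_surjective m
  have ha : 0 < a := Real.sinh_pos_iff.1 h0
  have h1 : ∑ i, Real.sinh a * (a - w i) ≤
      ∑ i, 2 * a * max (Real.sinh a - Real.sinh (w i)) 0 :=
    Finset.sum_le_sum fun i _ => mul_sub_le_max_sinh_sub ha (w i)
  rw [← Finset.mul_sum, ← Finset.mul_sum, Finset.sum_sub_distrib, hw] at h1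
  simp only [Finset.sum_const, Finset.card_univ, Fintype.card_fin, nsmul_eq_mul, sub_zero] at h1
  have h2 : ∀ i, |Real.sinh (w i) - Real.sinh a| =
      2 * max (Real.sinh a - Real.sinh (w i)) 0 + (Real.sinh (w i) - Real.sinh a) := by
    intro i
    rcases le_total (Real.sinh a) (Real.sinh (w i)) with h | h
    · rw [abs_of_nonneg (by linarith), max_eq_right (by linarith)]; ring
    · rw [abs_of_nonpos (by linarith), max_eq_left (by linarith)]; ring
  simp only [h2, Finset.sum_add_distrib, Finset.sum_sub_distrib, hm, ← Finset.mul_sum,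
    Finset.sum_const, Finset.card_univ, Fintype.card_fin, nsmul_eq_mul]
  have h3 : a * (n * Real.sinh a) ≤
      a * (2 * ∑ i, max (Real.sinh a - Real.sinh (w i)) 0) := by linarith
  linarith [le_of_mul_le_mul_left h3 ha]

/-- If `w` has mean zero, then the mean difference of `sinh ∘ w` is at least half the mean of
`|sinh ∘ w|`. -/
lemma sum_abs_sinh_le_sum_sum_abs_sub (w : Fin n → ℝ) (hw : ∑ i, w i = 0) :
    n * ∑ i, |Real.sinh (w i)| ≤ 2 * ∑ i, ∑ j, |Real.sinh (w i) - Real.sinh (w j)| := by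
  rcases Nat.eq_zero_or_pos n with rfl | hn
  · simp
  have hn' : (0 : ℝ) < n := by exact_mod_cast hn
  obtain ⟨m, hm⟩ : ∃ m, ∑ i, Real.sinh (w i) = n * m :=
    ⟨(∑ i, Real.sinh (w i)) / n, by field_simp⟩
  have h1 := sum_sinh_le_sum_abs_sub w hw m hm
  have h2 := sum_sinh_le_sum_abs_sub (fun i => -w i) (by simp [hw]) (-m)
    (by simp only [Real.sinh_neg, Finset.sum_neg_distrib, hm]; ring)
  have h3 : ∀ i, |Real.sinh (-w i) - -m| = |Real.sinh (w i) - m| := fun i => by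
    rw [Real.sinh_neg, ← abs_neg]; congr 1; ring
  simp only [h3] at h2
  have h4 : n * |m| ≤ ∑ i, |Real.sinh (w i) - m| := by
    rcases abs_cases m with h | h <;> rw [h.1] <;> assumption
  have h5 : ∑ i, |Real.sinh (w i)| ≤ ∑ i, |Real.sinh (w i) - m| + n * |m| := by
    calc ∑ i, |Real.sinh (w i)| ≤ ∑ i, (|Real.sinh (w i) - m| + |m|) := by
          gcongr with i
          simpa using abs_add_le (Real.sinh (w i) - m) m
      _ = _ := by simp [Finset.sum_add_distrib]
  have h6 : n * ∑ i, |Real.sinh (w i) - m| ≤ ∑ i, ∑ j, |Real.sinh (w i) - Real.sinh (w j)| := by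
    rw [Finset.mul_sum]
    gcongr with i
    calc n * |Real.sinh (w i) - m| = |∑ j, (Real.sinh (w i) - Real.sinh (w j))| := by
          rw [Finset.sum_sub_distrib, hm]
          simp only [Finset.sum_const, Finset.card_univ, Fintype.card_fin, nsmul_eq_mul]
          rw [← mul_sub, abs_mul, abs_of_pos hn']
      _ ≤ _ := Finset.abs_sum_le_sum_abs _ _
  nlinarith

lemma cosh_add_le (a : ℝ) {b : ℝ} (hb : |b| ≤ 1) :
    Real.cosh (a + b) ≤ Real.cosh a + b * Real.sinh a + b ^ 2 * Real.cosh a := by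
  have h1 := (abs_le.1 (Real.abs_exp_sub_one_sub_id_le hb)).2
  have h2 := (abs_le.1 (Real.abs_exp_sub_one_sub_id_le (x := -b) (by rwa [abs_neg]))).2
  have h3 := mul_le_mul_of_nonneg_left h1 (Real.exp_pos a).le
  have h4 := mul_le_mul_of_nonneg_left h2 (Real.exp_pos (-a)).le
  rw [Real.cosh_eq, Real.cosh_eq, Real.sinh_eq, neg_add, Real.exp_add, Real.exp_add]
  nlinarith

lemma cosh_le_one_add_abs_sinh (a : ℝ) : Real.cosh a ≤ 1 + |Real.sinh a| := by
  refine abs_le_of_sq_le_sq' ?_ (by positivity) |>.2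
  rw [Real.cosh_sq]
  nlinarith [sq_abs (Real.sinh a), abs_nonneg (Real.sinh a)]

/-! ### Drift of the hyperbolic cosine potential -/

/-- The load of bin `i` minus the average load of the vector `x`. -/
def excess (x : Fin n → ℕ) (i : Fin n) : ℝ := x i - (∑ j, (x j : ℝ)) / n

/-- The potential `∑ i, cosh (excess x i / 24)`. The constant `1 / 24` makes the second order terms
in the one step change at most half of the first order term. -/
def potential (x : Fin n → ℕ) : ℝ := ∑ i, Real.cosh (excess x i / 24)

lemma excess_addBall (x : Fin n → ℕ) (k i : Fin n) :
    excess (addBall x k) i = excess x i + ((if i = k then 1 else 0) - 1 / n) := by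
  have h : ∑ j, (addBall x k j : ℝ) = ∑ j, (x j : ℝ) + 1 := by exact_mod_cast sum_addBall x k
  rw [excess, excess, h, addBall, Function.update_apply]
  split_ifs with hi
  · subst hi; push_cast; ring
  · ring

lemma sum_excess [NeZero n] (x : Fin n → ℕ) : ∑ i, excess x i = 0 := by
  have hn : (n : ℝ) ≠ 0 := by exact_mod_cast NeZero.ne n
  simp only [excess, Finset.sum_sub_distrib, Finset.sum_const, Finset.card_univ, Fintype.card_fin,
    nsmul_eq_mul]
  field_simp
  ring

lemma le_potential (x : Fin n → ℕ) : (n : ℝ) ≤ potential x := by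
  calc (n : ℝ) = ∑ _i : Fin n, (1 : ℝ) := by simp
    _ ≤ _ := Finset.sum_le_sum fun i _ => Real.one_le_cosh _

lemma potential_addBall_le [NeZero n] (x : Fin n → ℕ) (k : Fin n) :
    potential (addBall x k) ≤
      potential x + (1 / 24) * (Real.sinh (excess x k / 24) -
        (∑ i, Real.sinh (excess x i / 24)) / n) +
      (1 / 24) ^ 2 * (Real.cosh (excess x k / 24) + potential x / n) := by
  have hn : (1 : ℝ) ≤ n := by exact_mod_cast Nat.one_le_iff_ne_zero.2 (NeZero.ne n)
  have hn1 : 1 / (n : ℝ) ≤ 1 := (div_le_one (by linarith)).2 hn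
  have hn0 : 0 ≤ 1 / (n : ℝ) := by positivity
  have h : ∀ i, Real.cosh (excess (addBall x k) i / 24) ≤
      Real.cosh (excess x i / 24) + (1 / 24) * ((if i = k then Real.sinh (excess x i / 24) else 0)
        - Real.sinh (excess x i / 24) / n) +
      (1 / 24) ^ 2 * ((if i = k then Real.cosh (excess x i / 24) else 0)
        + Real.cosh (excess x i / 24) / n) := by
    intro i
    have hc := Real.cosh_pos (excess x i / 24)
    set d : ℝ := (if i = k then 1 else 0) - 1 / n with hd
    have hd1 : |d| ≤ 1 := by
      rw [hd, abs_le]; split_ifs <;> constructor <;> linarith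
    have h1 := cosh_add_le (excess x i / 24) (b := d / 24) (by
      rw [abs_div, abs_of_pos (by norm_num : (0 : ℝ) < 24)]; linarith)
    rw [excess_addBall, add_div]
    refine h1.trans ?_
    have hd2 : d ^ 2 ≤ (if i = k then 1 else 0) + 1 / n := by
      rw [hd]; split_ifs <;> nlinarith
    have h2 := mul_le_mul_of_nonneg_right hd2 hc.le
    have h3 : d * Real.sinh (excess x i / 24) =
        (if i = k then Real.sinh (excess x i / 24) else 0) - Real.sinh (excess x i / 24) / n := by
      rw [hd]; split_ifs <;> ring
    have h4 : ((if i = k then 1 else 0) + 1 / (n : ℝ)) * Real.cosh (excess x i / 24) =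
        (if i = k then Real.cosh (excess x i / 24) else 0) + Real.cosh (excess x i / 24) / n := by
      split_ifs <;> ring
    rw [← h3, ← h4]
    nlinarith
  refine (Finset.sum_le_sum fun i _ => h i).trans_eq ?_
  simp only [Finset.sum_add_distrib, ← Finset.mul_sum, Finset.sum_sub_distrib, ← Finset.sum_div,
    Finset.sum_ite_eq', Finset.mem_univ, if_true, potential]

/-- The potential has negative drift where it is large. -/
lemma transition_potential_le [NeZero n] (x : Fin n → ℕ) :
    transition potential x ≤ (1 - 1 / (192 * n)) * potential x + 1 / 96 := by
  have hn : (0 : ℝ) < n := by exact_mod_cast Nat.pos_of_ne_zero (NeZero.ne n)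
  set S : Fin n → ℝ := fun i => Real.sinh (excess x i / 24) with hS
  set m : ℝ := (∑ i, S i) / n with hm
  set D : ℝ := ∑ i, ∑ j, |S i - S j| with hD
  have hmono : Monotone fun l : ℕ => Real.sinh ((l - (∑ j, (x j : ℝ)) / n) / 24) := by
    intro a b hab
    have : (a : ℝ) ≤ b := by exact_mod_cast hab
    refine Real.sinh_le_sinh.2 ?_
    linarith
  have h1 : binMean x S = m - D / (2 * (n : ℝ) ^ 2) := by
    have h := binMean_of_monotone x hmono
    exact h
  have h2 : binMean x (fun k => Real.cosh (excess x k / 24)) ≤ 2 * potential x / n :=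
    binMean_le_two_mul x fun k => (Real.cosh_pos _).le
  have h3 : n * ∑ i, |S i| ≤ 2 * D :=
    sum_abs_sinh_le_sum_sum_abs_sub (fun i => excess x i / 24) (by
      rw [← Finset.sum_div, sum_excess, zero_div])
  have h4 : potential x ≤ n + ∑ i, |S i| := by
    refine (Finset.sum_le_sum fun i _ => cosh_le_one_add_abs_sinh _).trans_eq ?_
    simp [Finset.sum_add_distrib, hS]
  have h5 : transition potential x ≤ binMean x fun k =>
      ((potential x - (1 / 24) * m + (1 / 24) ^ 2 * (potential x / n)) + (1 / 24) * S k) +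
        (1 / 24) ^ 2 * Real.cosh (excess x k / 24) := by
    refine binMean_mono x fun k => (potential_addBall_le x k).trans_eq ?_
    simp only [hm, hS]; ring
  rw [binMean_add, binMean_add, binMean_const, binMean_const_mul, binMean_const_mul, h1] at h5
  have h6 : potential x / n ≤ 1 + 2 * (D / n ^ 2) := by
    have : potential x * n ≤ n ^ 2 + 2 * D := by nlinarith
    calc potential x / n = potential x * n / n ^ 2 := by field_simp
      _ ≤ (n ^ 2 + 2 * D) / n ^ 2 := by gcongr
      _ = _ := by field_simp
  have h7 : D / (2 * (n : ℝ) ^ 2) = D / n ^ 2 / 2 := by field_simp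
  have h8 : 2 * potential x / n = 2 * (potential x / n) := by ring
  have h9 : (1 - 1 / (192 * n)) * potential x = potential x - (potential x / n) / 192 := by
    field_simp
  rw [h7] at h5
  rw [h8] at h2
  rw [h9]
  linarith

lemma iterate_transition_potential_le [NeZero n] (t : ℕ) (x : Fin n → ℕ) :
    transition^[t] potential x ≤ (1 - 1 / (192 * n)) ^ t * potential x + 2 * n := by
  have hn : (1 : ℝ) ≤ n := by exact_mod_cast Nat.one_le_iff_ne_zero.2 (NeZero.ne n)
  induction t with
  | zero => simp only [Function.iterate_zero, id, pow_zero, one_mul]; linarith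
  | succ t ih =>
    have hr : 0 ≤ 1 - 1 / (192 * (n : ℝ)) := by
      rw [sub_nonneg, div_le_one (by positivity)]; linarith
    rw [Function.iterate_succ_apply]
    calc transition^[t] (transition potential) x
        ≤ transition^[t] (fun y => (1 - 1 / (192 * n)) * potential y + 1 / 96) x :=
          iterate_transition_mono t x fun y _ => transition_potential_le y
      _ = (1 - 1 / (192 * n)) * transition^[t] potential x + 1 / 96 := by
          rw [iterate_transition_add, iterate_transition_const_mul, iterate_transition_const]
      _ ≤ (1 - 1 / (192 * n)) * ((1 - 1 / (192 * n)) ^ t * potential x + 2 * n) + 1 / 96 := by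
          gcongr
      _ = (1 - 1 / (192 * n)) ^ (t + 1) * potential x + 2 * n := by
          have : (1 - 1 / (192 * (n : ℝ))) * (2 * n) = 2 * n - 1 / 96 := by field_simp; ring
          rw [mul_add, this]
          ring

/-! ### Probabilities for the process started at a given load vector -/

/-- The probability that the process started at `x` is in `A` after `t` steps. -/
def prob (t : ℕ) (x : Fin n → ℕ) (A : Set (Fin n → ℕ)) : ℝ :=
  transition^[t] (A.indicator 1) x

/-- Markov's inequality. -/
lemma prob_le_iterate_transition (t : ℕ) (x : Fin n → ℕ) (A : Set (Fin n → ℕ))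
    {F : (Fin n → ℕ) → ℝ} (hF : ∀ y, 0 ≤ F y)
    (h : ∀ y ∈ A, ∑ i, y i = ∑ i, x i + t → 1 ≤ F y) :
    prob t x A ≤ transition^[t] F x := by
  refine iterate_transition_mono t x fun y hy => ?_
  by_cases hA : y ∈ A
  · simpa [hA] using h y hA hy
  · simpa [hA] using hF y

lemma indicator_one_nonneg {α : Type*} (A : Set α) (y : α) :
    0 ≤ A.indicator (1 : α → ℝ) y :=
  Set.indicator_nonneg (fun _ _ => zero_le_one) y

lemma prob_mono (t : ℕ) (x : Fin n → ℕ) {A B : Set (Fin n → ℕ)}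
    (h : ∀ y ∈ A, ∑ i, y i = ∑ i, x i + t → y ∈ B) : prob t x A ≤ prob t x B :=
  prob_le_iterate_transition t x A (indicator_one_nonneg B) fun y hA hy => by simp [h y hA hy]

lemma prob_union_le (t : ℕ) (x : Fin n → ℕ) (A B : Set (Fin n → ℕ)) :
    prob t x (A ∪ B) ≤ prob t x A + prob t x B := by
  rw [prob.eq_def t x A, prob.eq_def t x B, ← iterate_transition_add]
  refine prob_le_iterate_transition t x _
    (fun y => add_nonneg (indicator_one_nonneg A y) (indicator_one_nonneg B y)) ?_
  rintro y (hA | hB) -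
  · have := indicator_one_nonneg B y
    simpa [hA] using this
  · have := indicator_one_nonneg A y
    simpa [hB] using this

lemma prob_le_one [NeZero n] (t : ℕ) (x : Fin n → ℕ) (A : Set (Fin n → ℕ)) : prob t x A ≤ 1 :=
  (prob_le_iterate_transition t x A (fun _ => zero_le_one) fun _ _ _ => le_rfl).trans_eq
    (iterate_transition_const t 1 x)

lemma prob_compl [NeZero n] (t : ℕ) (x : Fin n → ℕ) (A : Set (Fin n → ℕ)) :
    prob t x A + prob t x Aᶜ = 1 := by
  rw [prob, prob, ← iterate_transition_add, ← iterate_transition_const t 1 x]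
  refine congrArg (fun f => transition^[t] f x) (funext fun y => ?_)
  by_cases h : y ∈ A <;> simp [h]

/-- Markov property: to bound the probability of `A` at time `s + t`, bound the probability of
leaving the set `S` of good load vectors at time `s`, and that of `A` from a good load vector. -/
lemma prob_add_le [NeZero n] (s t : ℕ) (x : Fin n → ℕ) (A S : Set (Fin n → ℕ)) {ε : ℝ}
    (hε : 0 ≤ ε) (h : ∀ y ∈ S, ∑ i, y i = ∑ i, x i + s → prob t y A ≤ ε) :
    prob (s + t) x A ≤ prob s x Sᶜ + ε := by
  rw [← iterate_transition_const s ε x, prob, prob, Function.iterate_add_apply,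
    ← iterate_transition_add]
  refine iterate_transition_mono s x fun y hy => ?_
  by_cases hS : y ∈ S
  · have := h y hS hy
    rw [prob] at this
    simpa [hS] using this
  · have := prob_le_one t y A
    simp only [prob] at this
    simp only [Set.mem_compl_iff, hS, not_false_eq_true, Set.indicator_of_mem, Pi.one_apply]
    linarith

/-! ### Concentration of functions with unit increments -/

/-- Each additional ball increases `F` by an amount in `[0, 1]`. -/
def HasUnitIncrements (F : (Fin n → ℕ) → ℝ) : Prop :=
  ∀ x a, F x ≤ F (addBall x a) ∧ F (addBall x a) ≤ F x + 1

lemma addBall_apply (x : Fin n → ℕ) (a i : Fin n) :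
    addBall x a i = x i + if i = a then 1 else 0 := by
  rw [addBall, Function.update_apply]
  split_ifs with h
  · rw [h]
  · rfl

lemma addBall_comm (x : Fin n → ℕ) (a b : Fin n) :
    addBall (addBall x a) b = addBall (addBall x b) a := by
  ext i
  simp only [addBall_apply]
  ring

/-- The transition operator preserves unit increments. Couple the processes started at `x` and at
`addBall x a` by sampling the same two bins; if the balls then go to different bins, the one of the
process started at `x` goes to `a`, so that the second load vector still has one ball more. -/
lemma HasUnitIncrements.transition [NeZero n] {F : (Fin n → ℕ) → ℝ} (hF : HasUnitIncrements F) :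
    HasUnitIncrements (transition F) := by
  intro x a
  set g : Fin n → ℝ := fun k => F (addBall x k) with hg
  set g' : Fin n → ℝ := fun k => F (addBall (addBall x a) k) with hg'
  have h1 : ∀ k, g k ≤ g' k ∧ g' k ≤ g k + 1 := fun k => by
    rw [hg, hg']
    simp only [addBall_comm x a k]
    exact hF _ a
  have h2 : ∀ k, g a ≤ g' k ∧ g' k ≤ g a + 1 := fun k => hF _ k
  have key : ∀ i j, pick x i j g ≤ pick (addBall x a) i j g' ∧
      pick (addBall x a) i j g' ≤ pick x i j g + 1 := by
    intro i j
    obtain ⟨hi, hi'⟩ := h1 i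
    obtain ⟨hj, hj'⟩ := h1 j
    obtain ⟨hai, hai'⟩ := h2 i
    obtain ⟨haj, haj'⟩ := h2 j
    simp only [pick, addBall_apply]
    by_cases hia : i = a
    · subst hia
      by_cases hja : j = i
      · subst hja
        simp only [lt_irrefl, if_false]
        constructor <;> linarith
      · simp only [if_true, hja, if_false]
        split_ifs <;> first | omega | (constructor <;> linarith)
    · by_cases hja : j = a
      · subst hja
        simp only [if_true, hia, if_false]
        split_ifs <;> first | omega | (constructor <;> linarith)
      · simp only [hia, hja, if_false, add_zero]
        split_ifs <;> constructor <;> linarith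
  have hn : (n : ℝ) ≠ 0 := by exact_mod_cast NeZero.ne n
  constructor
  · change binMean x g ≤ binMean _ g'
    unfold binMean
    gcongr with i _ j _
    exact (key i j).1
  · change binMean _ g' ≤ binMean x g + 1
    calc binMean (addBall x a) g' ≤ (∑ i, ∑ j, (pick x i j g + 1)) / (n : ℝ) ^ 2 := by
          unfold binMean
          gcongr with i _ j _
          exact (key i j).2
      _ = _ := by
          simp only [Finset.sum_add_distrib, Finset.sum_const, Finset.card_univ, Fintype.card_fin,
            nsmul_eq_mul, binMean]
          field_simp

/-- Since one step moves the conditional expectation by a quantity in an interval of length one,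
`exp u ≤ 1 + u + u ^ 2` for `|u| ≤ 1` bounds the exponential moment of the deviation. -/
lemma transition_exp_le [NeZero n] {F : (Fin n → ℕ) → ℝ} (hF : HasUnitIncrements F) {r : ℝ}
    (h0 : 0 ≤ r) (h1 : r ≤ 1) (x : Fin n → ℕ) :
    transition (fun y => Real.exp (r * F y)) x ≤
      Real.exp (r ^ 2) * Real.exp (r * transition F x) := by
  set μ := transition F x with hμ
  have hμ1 : F x ≤ μ := by
    rw [← binMean_const x (F x)]
    exact binMean_mono x fun k => (hF x k).1
  have hμ2 : μ ≤ F x + 1 := by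
    rw [← binMean_const x (F x + 1)]
    exact binMean_mono x fun k => (hF x k).2
  calc transition (fun y => Real.exp (r * F y)) x
      ≤ binMean x fun k => Real.exp (r * μ) * ((1 + r ^ 2 - r * μ) + r * F (addBall x k)) := by
        refine binMean_mono x fun k => ?_
        obtain ⟨hk1, hk2⟩ := hF x k
        have hd : |F (addBall x k) - μ| ≤ 1 := abs_le.2 ⟨by linarith, by linarith⟩
        have hd' : |r * (F (addBall x k) - μ)| ≤ 1 := by
          rw [abs_mul, abs_of_nonneg h0]
          exact mul_le_one₀ h1 (abs_nonneg _) hd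
        have h2 := (abs_le.1 (Real.abs_exp_sub_one_sub_id_le hd')).2
        have h3 : (F (addBall x k) - μ) ^ 2 ≤ 1 := (sq_le_one_iff_abs_le_one _).2 hd
        have h4 : Real.exp (r * F (addBall x k)) =
            Real.exp (r * μ) * Real.exp (r * (F (addBall x k) - μ)) := by
          rw [← Real.exp_add]; congr 1; ring
        simp only [h4]
        gcongr
        nlinarith [mul_le_mul_of_nonneg_left h3 (sq_nonneg r)]
    _ = Real.exp (r * μ) * (r ^ 2 + 1) := by
        rw [binMean_const_mul, binMean_add, binMean_const, binMean_const_mul]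
        have : binMean x (fun k => F (addBall x k)) = μ := rfl
        rw [this]; ring
    _ ≤ Real.exp (r * μ) * Real.exp (r ^ 2) := by
        gcongr
        exact Real.add_one_le_exp _
    _ = _ := mul_comm _ _

lemma iterate_transition_exp_le [NeZero n] (t : ℕ) {F : (Fin n → ℕ) → ℝ}
    (hF : HasUnitIncrements F) {r : ℝ} (h0 : 0 ≤ r) (h1 : r ≤ 1) (x : Fin n → ℕ) :
    transition^[t] (fun y => Real.exp (r * F y)) x ≤
      Real.exp (r * transition^[t] F x + t * r ^ 2) := by
  induction t generalizing F with
  | zero => simp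
  | succ t ih =>
    simp only [Function.iterate_succ_apply]
    calc transition^[t] (transition fun y => Real.exp (r * F y)) x
        ≤ transition^[t] (fun y => Real.exp (r ^ 2) * Real.exp (r * transition F y)) x :=
          iterate_transition_mono t x fun y _ => transition_exp_le hF h0 h1 y
      _ ≤ Real.exp (r ^ 2) * Real.exp (r * transition^[t] (transition F) x + t * r ^ 2) := by
          rw [iterate_transition_const_mul]
          gcongr
          exact ih hF.transition
      _ = _ := by
          rw [← Real.exp_add]
          push_cast
          congr 1
          ring

/-- Upper tail bound for functions with unit increments. -/
lemma prob_lt_le_exp [NeZero n] (t : ℕ) {F : (Fin n → ℕ) → ℝ} (hF : HasUnitIncrements F) {r : ℝ}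
    (h0 : 0 ≤ r) (h1 : r ≤ 1) (x : Fin n → ℕ) (b : ℝ) :
    prob t x {y | b < F y} ≤ Real.exp (r * (transition^[t] F x - b) + t * r ^ 2) := by
  calc prob t x {y | b < F y}
      ≤ transition^[t] (fun y => Real.exp (-(r * b)) * Real.exp (r * F y)) x := by
        refine prob_le_iterate_transition t x _ (fun y => by positivity) fun y hy _ => ?_
        rw [← Real.exp_add, Real.one_le_exp_iff]
        have : r * b ≤ r * F y := mul_le_mul_of_nonneg_left (le_of_lt hy) h0
        linarith
    _ ≤ Real.exp (-(r * b)) * Real.exp (r * transition^[t] F x + t * r ^ 2) := by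
        rw [iterate_transition_const_mul]
        gcongr
        exact iterate_transition_exp_le t hF h0 h1 x
    _ = _ := by
        rw [← Real.exp_add]
        congr 1
        ring

/-! ### Layers -/

/-- The number of bins with load at least `h`. -/
def aboveCount (h : ℕ) (x : Fin n → ℕ) : ℕ := ∑ i, if h ≤ x i then 1 else 0

/-- The number of balls above height `h`, that is, of balls which have at least `h` balls below
them in their bin. -/
def overflow (h : ℕ) (x : Fin n → ℕ) : ℕ := ∑ i, (x i - h)

lemma sum_comp_addBall (x : Fin n → ℕ) (a : Fin n) (φ : ℕ → ℕ) (c : ℕ)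
    (hc : φ (x a + 1) = φ (x a) + c) : ∑ i, φ (addBall x a i) = ∑ i, φ (x i) + c := by
  have : ∀ i, φ (addBall x a i) = φ (x i) + if i = a then c else 0 := by
    intro i
    rw [addBall_apply]
    split_ifs with h
    · rw [h, hc]
    · rfl
  simp [this, Finset.sum_add_distrib]

lemma aboveCount_addBall (h : ℕ) (x : Fin n → ℕ) (a : Fin n) :
    aboveCount h (addBall x a) = aboveCount h x + if x a + 1 = h then 1 else 0 :=
  sum_comp_addBall x a (fun l => if h ≤ l then 1 else 0) _ (by
    split_ifs <;> omega)

lemma overflow_addBall (h : ℕ) (x : Fin n → ℕ) (a : Fin n) :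
    overflow h (addBall x a) = overflow h x + if h ≤ x a then 1 else 0 :=
  sum_comp_addBall x a (fun l => l - h) _ (by
    split_ifs <;> omega)

lemma hasUnitIncrements_aboveCount (h : ℕ) :
    HasUnitIncrements fun x : Fin n → ℕ => (aboveCount h x : ℝ) := by
  intro x a
  simp only [aboveCount_addBall]
  split_ifs <;> constructor <;> push_cast <;> linarith

lemma aboveCount_succ_le_overflow (h : ℕ) (x : Fin n → ℕ) :
    aboveCount (h + 1) x ≤ overflow h x :=
  Finset.sum_le_sum fun i _ => by split_ifs <;> omega

lemma le_add_overflow (h : ℕ) (x : Fin n → ℕ) (i : Fin n) : x i ≤ h + overflow h x := by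
  have := Finset.single_le_sum (f := fun i => x i - h) (fun _ _ => Nat.zero_le _)
    (Finset.mem_univ i)
  unfold overflow
  omega

/-- A ball falls above height `h` only if both sampled bins have load at least `h`. -/
lemma binMean_ite_le (h : ℕ) (x : Fin n → ℕ) :
    binMean x (fun k => if h ≤ x k then 1 else 0) ≤ (aboveCount h x / n : ℝ) ^ 2 := by
  have h1 : ∀ i j, pick x i j (fun k => if h ≤ x k then (1 : ℝ) else 0) ≤
      (if h ≤ x i then 1 else 0) * (if h ≤ x j then 1 else 0) := by
    intro i j
    simp only [pick]
    split_ifs <;> first | omega | norm_num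
  rw [div_pow]
  unfold binMean
  gcongr
  calc _ ≤ ∑ i, ∑ j, (if h ≤ x i then (1 : ℝ) else 0) * (if h ≤ x j then 1 else 0) := by
        gcongr with i _ j _
        exact h1 i j
    _ = _ := by
        rw [← Finset.sum_mul_sum, pow_two]
        simp [aboveCount]

/-- One step raises the overflow only by going above height `h`, which has probability at most
`(b / n) ^ 2` as long as at most `b` bins have load at least `h`. The event is restricted to
`aboveCount h y ≤ b` at the end of the step; this implies the same bound at its start. -/
lemma transition_layer_le [NeZero n] (h k : ℕ) (b : ℝ) (x : Fin n → ℕ) :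
    transition ({y | k + 1 ≤ overflow h y ∧ (aboveCount h y : ℝ) ≤ b}.indicator 1) x ≤
      {y | k + 1 ≤ overflow h y ∧ (aboveCount h y : ℝ) ≤ b}.indicator 1 x +
        (b / n) ^ 2 * {y | k ≤ overflow h y ∧ (aboveCount h y : ℝ) ≤ b}.indicator 1 x := by
  set A : Set (Fin n → ℕ) := {y | k + 1 ≤ overflow h y ∧ (aboveCount h y : ℝ) ≤ b} with hA
  set B : Set (Fin n → ℕ) := {y | k ≤ overflow h y ∧ (aboveCount h y : ℝ) ≤ b} with hB
  have h1 : transition (A.indicator 1) x ≤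
      binMean x fun k => A.indicator 1 x + B.indicator 1 x * (if h ≤ x k then 1 else 0) := by
    refine binMean_mono x fun a => ?_
    have h2 : ∀ y : Fin n → ℕ, ∀ S : Set (Fin n → ℕ), 0 ≤ S.indicator (1 : (Fin n → ℕ) → ℝ) y :=
      fun y S => indicator_one_nonneg S y
    by_cases hy : addBall x a ∈ A
    · have hy' := hy
      rw [hA, Set.mem_ofPred_eq, overflow_addBall] at hy'
      have h3 : (aboveCount h x : ℝ) ≤ b := (hasUnitIncrements_aboveCount h x a).1.trans hy'.2
      by_cases hx : h ≤ x a
      · have hxB : x ∈ B := ⟨by simpa [hx] using hy'.1, h3⟩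
        simpa [hy, hx, hxB] using h2 x A
      · have hxA : x ∈ A := ⟨by simpa [hx] using hy'.1, h3⟩
        simp [hy, hx, hxA]
    · rw [Set.indicator_of_notMem hy]
      have := h2 x A
      have := h2 x B
      positivity
  rw [binMean_add, binMean_const, binMean_const_mul, mul_comm] at h1
  refine h1.trans (add_le_add le_rfl ?_)
  by_cases hx : x ∈ B
  · simp only [hx, Set.indicator_of_mem, Pi.one_apply, mul_one]
    refine (binMean_ite_le h x).trans ?_
    gcongr
    exact hx.2
  · simp [hx]

/-- The layer bound: if no ball is above height `h` at the start, and at the end at most `b` bins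
have load at least `h`, then at all times in between at most `b` bins had load at least `h`, so
that each ball went above height `h` with probability at most `(b / n) ^ 2`. -/
lemma prob_layer_le_choose [NeZero n] (t h k : ℕ) (b : ℝ) (x : Fin n → ℕ) (hx : overflow h x = 0) :
    prob t x {y | k ≤ overflow h y ∧ (aboveCount h y : ℝ) ≤ b} ≤
      t.choose k * ((b / n) ^ 2) ^ k := by
  induction t generalizing k with
  | zero =>
    rcases k with _ | k
    · simpa using prob_le_one 0 x _
    · simp [prob, hx]
  | succ t ih =>
    rcases k with _ | k
    · simpa using prob_le_one (t + 1) x _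
    · rw [prob, Function.iterate_succ_apply]
      refine (iterate_transition_mono t x fun y _ => transition_layer_le h k b y).trans ?_
      rw [iterate_transition_add, iterate_transition_const_mul]
      have h1 := ih (k + 1)
      have h2 := mul_le_mul_of_nonneg_left (ih k) (sq_nonneg (b / n))
      rw [prob] at h1 h2
      refine (add_le_add h1 h2).trans_eq ?_
      rw [Nat.choose_succ_succ]
      push_cast
      ring

lemma prob_layer_le [NeZero n] (t h k : ℕ) (b : ℝ) (x : Fin n → ℕ) (hx : overflow h x = 0) :
    prob t x {y | k ≤ overflow h y ∧ (aboveCount h y : ℝ) ≤ b} ≤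
      (t * (b / n) ^ 2) ^ k / k.factorial := by
  refine (prob_layer_le_choose t h k b x hx).trans ?_
  rw [mul_pow, mul_div_right_comm]
  gcongr
  exact Nat.choose_le_pow_div k t

/-- The layer bound at a real threshold `c` that is large compared with the expected number of
balls above height `h`. -/
lemma prob_layer_lt_le [NeZero n] (t h : ℕ) (b c : ℝ) (hc : 0 < c)
    (hbc : Real.exp 2 * (t * (b / n) ^ 2) ≤ c) (x : Fin n → ℕ) (hx : overflow h x = 0) :
    prob t x {y | c < overflow h y ∧ (aboveCount h y : ℝ) ≤ b} ≤ Real.exp (-c) := by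
  set k := ⌊c⌋₊ + 1 with hk
  have hck : c < k := by rw [hk]; push_cast; exact Nat.lt_floor_add_one c
  have hk0 : (0 : ℝ) < k := hc.trans hck
  calc prob t x {y | c < overflow h y ∧ (aboveCount h y : ℝ) ≤ b}
      ≤ prob t x {y | k ≤ overflow h y ∧ (aboveCount h y : ℝ) ≤ b} :=
        prob_mono t x fun y hy _ => ⟨(Nat.floor_lt hc.le).2 hy.1, hy.2⟩
    _ ≤ (t * (b / n) ^ 2) ^ k / k.factorial := prob_layer_le t h k b x hx
    _ ≤ (Real.exp (-2) * k) ^ k / k.factorial := by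
        refine div_le_div_of_nonneg_right (pow_le_pow_left₀ (by positivity) ?_ k) (by positivity)
        rw [Real.exp_neg, ← div_eq_inv_mul, le_div_iff₀ (Real.exp_pos 2)]
        linarith
    _ = Real.exp (-2) ^ k * (k ^ k / k.factorial) := by rw [mul_pow, mul_div_assoc]
    _ ≤ Real.exp (-2) ^ k * Real.exp k := by
        gcongr
        exact Real.pow_div_factorial_le_exp _ hk0.le k
    _ = Real.exp (-k) := by
        rw [← Real.exp_nat_mul, ← Real.exp_add]
        congr 1
        ring
    _ ≤ _ := Real.exp_le_exp.2 (by linarith)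

/-! ### Tail bounds from the potential -/

lemma exp_le_two_mul_cosh (a : ℝ) : Real.exp a ≤ 2 * Real.cosh a := by
  rw [Real.cosh_eq]
  linarith [Real.exp_pos (-a)]

lemma exp_excess_le (x : Fin n → ℕ) (i : Fin n) :
    Real.exp (excess x i / 24) ≤ 2 * potential x := by
  refine (exp_le_two_mul_cosh _).trans ?_
  gcongr
  exact Finset.single_le_sum (f := fun i => Real.cosh (excess x i / 24))
    (fun i _ => (Real.cosh_pos _).le) (Finset.mem_univ i)

lemma aboveCount_mul_exp_le (x : Fin n → ℕ) (h : ℕ) (c : ℝ)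
    (hc : (∑ j, (x j : ℝ)) / n + c ≤ h) :
    aboveCount h x * Real.exp (c / 24) ≤ 2 * potential x := by
  rw [aboveCount, potential, Finset.mul_sum]
  push_cast
  rw [Finset.sum_mul]
  refine Finset.sum_le_sum fun i _ => le_trans ?_ (exp_le_two_mul_cosh (excess x i / 24))
  split_ifs with hi
  · have : (h : ℝ) ≤ x i := by exact_mod_cast hi
    rw [one_mul]
    gcongr
    rw [excess]
    linarith
  · rw [zero_mul]
    positivity

lemma iterate_transition_potential_zero_le [NeZero n] (t : ℕ) :
    transition^[t] potential (0 : Fin n → ℕ) ≤ 3 * n := by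
  have hn : (1 : ℝ) ≤ n := by exact_mod_cast Nat.one_le_iff_ne_zero.2 (NeZero.ne n)
  have h0 : potential (0 : Fin n → ℕ) = n := by simp [potential, excess]
  have h1 : (1 - 1 / (192 * (n : ℝ))) ^ t ≤ 1 := by
    refine pow_le_one₀ ?_ ?_
    · rw [sub_nonneg, div_le_one (by positivity)]; linarith
    · rw [sub_le_self_iff]; positivity
  have h2 := iterate_transition_potential_le t (0 : Fin n → ℕ)
  rw [h0] at h2
  nlinarith

/-- The probability that the process started with empty bins has a bin with excess larger than `c`
is at most `6 n exp (-c / 24)`. -/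
lemma prob_excess_le [NeZero n] (t : ℕ) (c : ℝ) :
    prob t (0 : Fin n → ℕ) {x | ∃ i, c < excess x i} ≤ 6 * n * Real.exp (-c / 24) := by
  calc prob t (0 : Fin n → ℕ) {x | ∃ i, c < excess x i}
      ≤ transition^[t] (fun x => (2 * Real.exp (-c / 24)) * potential x) 0 := by
        refine prob_le_iterate_transition t 0 _ (fun x => ?_) ?_
        · have := le_potential x
          have : (0 : ℝ) ≤ n := n.cast_nonneg
          have : 0 ≤ potential x := by linarith
          positivity
        · rintro x ⟨i, hi⟩ -
          have h1 : Real.exp (c / 24) ≤ 2 * potential x :=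
            (Real.exp_le_exp.2 (by linarith)).trans (exp_excess_le x i)
          calc (1 : ℝ) = Real.exp (-c / 24) * Real.exp (c / 24) := by
                rw [← Real.exp_add, neg_div, neg_add_cancel, Real.exp_zero]
            _ ≤ Real.exp (-c / 24) * (2 * potential x) := by gcongr
            _ = _ := by ring
    _ ≤ (2 * Real.exp (-c / 24)) * (3 * n) := by
        rw [iterate_transition_const_mul]
        gcongr
        exact iterate_transition_potential_zero_le t
    _ = _ := by ring

/-! ### Layered induction -/

/-- The bound `β i` for the number of bins with load at least `h + i` in the layered induction. As
long as it is above `5 log n`, the fraction `D β i / n` is squared in each layer. -/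
def layerBound (n : ℕ) (D : ℝ) (i : ℕ) : ℝ :=
  max (5 * Real.log n) (n / D * Real.exp (-2 ^ i))

lemma mul_layerBound_sq_le {D : ℝ} (hn : 1 < n) (hD : 0 < D) (h : 5 * D * Real.log n ≤ n) (i : ℕ) :
    D * layerBound n D i ^ 2 / n ≤ layerBound n D (i + 1) := by
  have hn0 : (0 : ℝ) < n := by positivity
  have hl : 0 < Real.log n := Real.log_pos (by exact_mod_cast hn)
  rcases max_choice (5 * Real.log n) (n / D * Real.exp (-2 ^ i)) with h1 | h1
  · refine le_max_of_le_left ?_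
    rw [layerBound, h1, div_le_iff₀ hn0]
    nlinarith
  · refine le_max_of_le_right ?_
    rw [layerBound, h1, mul_pow, ← Real.exp_nat_mul, div_le_iff₀ hn0]
    have : ((2 : ℕ) : ℝ) * -2 ^ i = -2 ^ (i + 1) := by push_cast; ring
    rw [this]
    refine le_of_eq ?_
    field_simp

/-- The induction over the layers: each layer adds at most `exp (-5 log n)` to the probability of
failure. -/
lemma prob_layerBound_lt_aboveCount_le [NeZero n] {t h L : ℕ} {ε : ℝ} (hn : 1 < n) (hL : 0 < L)
    (ht : t ≤ n * L) (hbig : 5 * (Real.exp 2 * L) * Real.log n ≤ n) (x : Fin n → ℕ)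
    (hx : ∀ i, x i ≤ h)
    (h0 : prob t x {y | layerBound n (Real.exp 2 * L) 0 < aboveCount h y} ≤ ε) (i : ℕ) :
    prob t x {y | layerBound n (Real.exp 2 * L) i < aboveCount (h + i) y} ≤
      ε + i * Real.exp (-(5 * Real.log n)) := by
  have hn0 : (0 : ℝ) < n := by positivity
  have hl : 0 < Real.log n := Real.log_pos (by exact_mod_cast hn)
  induction i with
  | zero => simpa using h0
  | succ i ih =>
    set b := layerBound n (Real.exp 2 * L) with hb
    have hover : overflow (h + i) x = 0 :=
      Finset.sum_eq_zero fun j _ => Nat.sub_eq_zero_of_le ((hx j).trans (Nat.le_add_right _ _))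
    have h5 : 5 * Real.log n ≤ b (i + 1) := le_max_left _ _
    have ht' : (t : ℝ) ≤ n * L := by exact_mod_cast ht
    have h1 := prob_layer_lt_le t (h + i) (b i) (b (i + 1)) (by linarith) (by
      refine le_trans ?_ (mul_layerBound_sq_le hn (by positivity) hbig i)
      calc Real.exp 2 * (t * (b i / n) ^ 2) ≤ Real.exp 2 * ((n * L) * (b i / n) ^ 2) := by gcongr
        _ = _ := by rw [← hb]; field_simp) x hover
    calc prob t x {y | b (i + 1) < aboveCount (h + (i + 1)) y}
        ≤ prob t x ({y | b i < aboveCount (h + i) y} ∪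
            {y | b (i + 1) < overflow (h + i) y ∧ (aboveCount (h + i) y : ℝ) ≤ b i}) := by
          refine prob_mono t x fun y hy _ => ?_
          rcases lt_or_ge (b i) (aboveCount (h + i) y) with h2 | h2
          · exact Or.inl h2
          · refine Or.inr ⟨lt_of_lt_of_le hy ?_, h2⟩
            exact_mod_cast aboveCount_succ_le_overflow (h + i) y
      _ ≤ (ε + i * Real.exp (-(5 * Real.log n))) + Real.exp (-(5 * Real.log n)) :=
          (prob_union_le t x _ _).trans (add_le_add ih (h1.trans (Real.exp_le_exp.2 (by linarith))))
      _ = _ := by push_cast; ring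

/-- Start of the layered induction: concentration of the number of bins with load at least `h`
around its mean, which is small by the bound on the potential. -/
lemma prob_lt_aboveCount_le [NeZero n] {t h L : ℕ} (hL : 0 < L) (ht : t ≤ n * L) {D c : ℝ}
    (hD : 1 ≤ D) (hbig : 64 * Real.exp 2 * D ^ 2 * L * Real.log n ≤ n) (x : Fin n → ℕ)
    (hpot : transition^[t] potential x ≤ 3 * n)
    (hc : Real.exp (c / 24) = 12 * Real.exp 1 * D)
    (hh : ((∑ i, (x i : ℝ)) + t) / n + c ≤ h) :
    prob t x {y | n / D * Real.exp (-1) < aboveCount h y} ≤ Real.exp (-(4 * Real.log n)) := by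
  have hn0 : (0 : ℝ) < n := by exact_mod_cast Nat.pos_of_ne_zero (NeZero.ne n)
  have hD0 : 0 < D := by linarith
  have hL1 : (1 : ℝ) ≤ L := by exact_mod_cast hL
  have ht' : (t : ℝ) ≤ n * L := by exact_mod_cast ht
  have he : 1 ≤ Real.exp 1 := Real.one_le_exp zero_le_one
  set e := Real.exp 1 with he_def
  have he2 : Real.exp 2 = e ^ 2 := by rw [he_def, ← Real.exp_nat_mul]; norm_num
  have hmean : transition^[t] (fun y => (aboveCount h y : ℝ)) x ≤ n / (2 * e * D) := by
    calc transition^[t] (fun y => (aboveCount h y : ℝ)) x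
        ≤ transition^[t] (fun y => (2 / (12 * e * D)) * potential y) x := by
          refine iterate_transition_mono t x fun y hy => ?_
          have hy' : ∑ i, (y i : ℝ) = ∑ i, (x i : ℝ) + t := by exact_mod_cast hy
          have h1 := aboveCount_mul_exp_le y h c (by rw [hy']; exact hh)
          rw [hc] at h1
          rw [div_mul_eq_mul_div, le_div_iff₀ (by positivity)]
          exact h1
      _ ≤ (2 / (12 * e * D)) * (3 * n) := by
          rw [iterate_transition_const_mul]
          gcongr
      _ = _ := by field_simp; norm_num
  -- this `r` minimizes the exponent of the tail bound for a deviation of `n / (2 * e * D)` in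
  -- `n * L` steps
  set r : ℝ := 1 / (4 * e * D * L) with hr
  have hr1 : r ≤ 1 := by
    rw [hr, div_le_one (by positivity)]
    have h1 : 1 ≤ e * D := one_le_mul_of_one_le_of_one_le he hD
    have h2 : 1 ≤ e * D * L := one_le_mul_of_one_le_of_one_le h1 hL1
    linarith
  refine (prob_lt_le_exp t (hasUnitIncrements_aboveCount h) (r := r) (by positivity) hr1 x
    (n / D * Real.exp (-1))).trans (Real.exp_le_exp.2 ?_)
  calc r * (transition^[t] (fun y => (aboveCount h y : ℝ)) x - n / D * Real.exp (-1)) + t * r ^ 2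
      ≤ r * (n / (2 * e * D) - n / D * Real.exp (-1)) + (n * L) * r ^ 2 := by gcongr
    _ = -(n / (16 * e ^ 2 * D ^ 2 * L)) := by
        rw [Real.exp_neg, ← he_def, hr]
        field_simp
        norm_num
    _ ≤ -(4 * Real.log n) := by
        rw [neg_le_neg_iff, le_div_iff₀ (by positivity)]
        rw [he2] at hbig
        linarith

lemma exists_le_two_pow {l : ℝ} (hl : 1 ≤ l) :
    ∃ k : ℕ, (k : ℝ) ≤ 2 * Real.log l + 1 ∧ l ≤ 2 ^ k := by
  have hll : 0 ≤ Real.log l := Real.log_nonneg hl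
  refine ⟨⌈2 * Real.log l⌉₊, (Nat.ceil_lt_add_one (by positivity)).le, ?_⟩
  have h1 : 2 * Real.log l ≤ ⌈2 * Real.log l⌉₊ := Nat.le_ceil _
  have h2 : (2 : ℝ) ^ ⌈2 * Real.log l⌉₊ = Real.exp (⌈2 * Real.log l⌉₊ * Real.log 2) := by
    rw [Real.exp_nat_mul, Real.exp_log two_pos]
  rw [h2, ← Real.log_le_iff_le_exp (by linarith)]
  calc Real.log l = 2 * Real.log l * (1 / 2) := by ring
    _ ≤ ⌈2 * Real.log l⌉₊ * Real.log 2 := by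
        gcongr
        linarith [Real.log_two_gt_d9]

lemma log_mul_le {l D : ℝ} (hl : 0 < l) (hD : 0 < D) (hDl : D ≤ 8008 * l) :
    Real.log (12 * Real.exp 1 * D) ≤ 13 + Real.log l := by
  have he := Real.exp_one_gt_d9
  have he' := Real.exp_one_lt_d9
  rw [← Real.log_exp 13, ← Real.log_mul (Real.exp_ne_zero _) hl.ne']
  refine Real.log_le_log (by positivity) ?_
  have h13 : (12 * 3 * 8008 : ℝ) ≤ Real.exp 13 := by
    have : Real.exp 13 = Real.exp 1 ^ 13 := by rw [← Real.exp_nat_mul]; norm_num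
    rw [this]
    calc (12 * 3 * 8008 : ℝ) ≤ 2.718 ^ 13 := by norm_num
      _ ≤ _ := by gcongr; linarith
  calc 12 * Real.exp 1 * D ≤ 12 * 3 * (8008 * l) := by gcongr; linarith
    _ = 12 * 3 * 8008 * l := by ring
    _ ≤ _ := by gcongr

/-- The gap bound for `t ≤ n L` steps from a load vector with all loads at most the final
average and with small expected final potential. -/
lemma prob_gap_le_of_start [NeZero n] {t L : ℕ} (hlog : Real.exp 1 ≤ Real.log n)
    (hbig : 10 ^ 22 * Real.log n ^ 15 ≤ n) (hL : 0 < L) (hL' : (L : ℝ) ≤ 1001 * Real.log n)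
    (ht : t ≤ n * L) (x : Fin n → ℕ) (hx : ∀ i, (x i : ℝ) ≤ ((∑ i, (x i : ℝ)) + t) / n)
    (hpot : transition^[t] potential x ≤ 3 * n) :
    prob t x {y | ∃ i, 344 * Real.log (Real.log n) < excess y i} ≤ 3 / (n : ℝ) ^ 4 := by
  set l := Real.log n with hl
  have he : 2.7182818283 < Real.exp 1 := Real.exp_one_gt_d9
  have he' : Real.exp 1 < 2.7182818286 := Real.exp_one_lt_d9
  have hl1 : 1 ≤ l := by linarith
  have hl0 : 0 < l := by linarith
  have hn0 : (0 : ℝ) < n := by exact_mod_cast Nat.pos_of_ne_zero (NeZero.ne n)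
  have hn : 1 < n := by
    by_contra h
    have : n = 1 := le_antisymm (not_lt.1 h) (Nat.one_le_iff_ne_zero.2 (NeZero.ne n))
    subst this
    simp at hl
    linarith
  have hexpl : Real.exp l = n := Real.exp_log hn0
  have hexp4 : Real.exp (-(4 * l)) = 1 / (n : ℝ) ^ 4 := by
    rw [Real.exp_neg, ← hexpl, ← Real.exp_nat_mul, one_div]; norm_num
  have hexp5 : Real.exp (-(5 * l)) = 1 / (n : ℝ) ^ 5 := by
    rw [Real.exp_neg, ← hexpl, ← Real.exp_nat_mul, one_div]; norm_num
  have he2 : Real.exp 2 = Real.exp 1 ^ 2 := by rw [← Real.exp_nat_mul]; norm_num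
  have he2' : Real.exp 2 ≤ 8 := by rw [he2]; nlinarith
  have he21 : 1 ≤ Real.exp 2 := Real.one_le_exp zero_le_two
  have hL1 : (1 : ℝ) ≤ L := by exact_mod_cast hL
  set D := Real.exp 2 * L with hD
  have hD1 : 1 ≤ D := one_le_mul_of_one_le_of_one_le he21 hL1
  have hD0 : 0 < D := by linarith
  have hDl : D ≤ 8008 * l := by nlinarith
  have hpow : ∀ k : ℕ, k ≤ 15 → 10 ^ 22 * l ^ k ≤ n := fun k hk =>
    le_trans (by gcongr) hbig
  -- the conditions on the size of `n` which the layered induction needs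
  have hc1 : 5 * D * l ≤ n := by
    have := hpow 2 (by norm_num)
    nlinarith
  have hc2 : 64 * Real.exp 2 * D ^ 2 * L * l ≤ n := by
    calc 64 * Real.exp 2 * D ^ 2 * L * l ≤ 64 * 8 * (8008 * l) ^ 2 * (1001 * l) * l := by gcongr
      _ = (64 * 8 * 8008 ^ 2 * 1001) * l ^ 4 := by ring
      _ ≤ 10 ^ 22 * l ^ 4 := by gcongr; norm_num
      _ ≤ n := hpow 4 (by norm_num)
  have hc3 : (25 * L * l ^ 2) ^ 5 ≤ n := by
    calc (25 * L * l ^ 2) ^ 5 ≤ (25 * (1001 * l) * l ^ 2) ^ 5 := by gcongr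
      _ = (25 * 1001) ^ 5 * l ^ 15 := by ring
      _ ≤ 10 ^ 22 * l ^ 15 := by gcongr; norm_num
      _ ≤ n := hbig
  -- the first layer
  set c := 24 * Real.log (12 * Real.exp 1 * D) with hc
  have hcexp : Real.exp (c / 24) = 12 * Real.exp 1 * D := by
    rw [hc, mul_div_cancel_left₀ _ (by norm_num), Real.exp_log (by positivity)]
  have hll1 : 1 ≤ Real.log l := by
    rw [Real.le_log_iff_exp_le hl0]; exact hlog
  have hc_nonneg : 0 ≤ c := by
    refine mul_nonneg (by norm_num) (Real.log_nonneg ?_)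
    nlinarith
  have hc_le : c ≤ 24 * (13 + Real.log l) := by
    rw [hc]
    gcongr
    exact log_mul_le hl0 hD0 hDl
  set M : ℝ := ((∑ i, (x i : ℝ)) + t) / n with hM
  have hM0 : 0 ≤ M := by positivity
  set h := ⌈M + c⌉₊ with hh
  have hMh : M + c ≤ h := Nat.le_ceil _
  have hh_le : (h : ℝ) ≤ M + c + 1 := (Nat.ceil_lt_add_one (by positivity)).le
  have hxh : ∀ i, x i ≤ h := fun i => by
    have : (x i : ℝ) ≤ h := (hx i).trans (by linarith)
    exact_mod_cast this
  have hstart : prob t x {y | layerBound n D 0 < aboveCount h y} ≤ 1 / (n : ℝ) ^ 4 := by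
    rw [← hexp4]
    refine le_trans (prob_mono t x fun y hy _ => ?_)
      (prob_lt_aboveCount_le hL ht hD1 hc2 x hpot hcexp hMh)
    have hy' : layerBound n D 0 < aboveCount h y := hy
    refine lt_of_le_of_lt ?_ hy'
    rw [layerBound, pow_zero]
    exact le_max_right _ _
  -- after `k` layers the bound `layerBound` has come down to `5 log n`
  obtain ⟨k, hk2, hlk⟩ := exists_le_two_pow hl1
  have hkn : (k : ℝ) ≤ n := by
    have := Real.log_le_sub_one_of_pos hl0
    have := hpow 1 (by norm_num)
    nlinarith
  have hbk : layerBound n D k ≤ 5 * l := by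
    refine max_le le_rfl ?_
    calc n / D * Real.exp (-2 ^ k) ≤ n / 1 * Real.exp (-l) := by gcongr
      _ = 1 := by rw [Real.exp_neg, hexpl]; field_simp
      _ ≤ 5 * l := by linarith
  have hlayers := prob_layerBound_lt_aboveCount_le hn hL ht hc1 x hxh hstart k
  rw [← hD, ← hl, hexp5] at hlayers
  -- above that layer there are at most four balls
  have hlast := prob_layer_le t (h + k) 5 (5 * l) x
    (Finset.sum_eq_zero fun j _ => Nat.sub_eq_zero_of_le ((hxh j).trans (Nat.le_add_right _ _)))
  have ht' : (t : ℝ) ≤ n * L := by exact_mod_cast ht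
  have hlast' : (t * (5 * l / n) ^ 2) ^ 5 / (Nat.factorial 5 : ℝ) ≤ 1 / (n : ℝ) ^ 4 := by
    calc (t * (5 * l / n) ^ 2) ^ 5 / (Nat.factorial 5 : ℝ)
        ≤ (n * L * (5 * l / n) ^ 2) ^ 5 / 1 := by
          gcongr
          exact_mod_cast Nat.factorial_pos 5
      _ = (25 * L * l ^ 2) ^ 5 / (n : ℝ) ^ 5 := by field_simp; ring
      _ ≤ n / (n : ℝ) ^ 5 := by gcongr
      _ = _ := by field_simp
  calc prob t x {y | ∃ i, 344 * Real.log l < excess y i}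
      ≤ prob t x ({y | layerBound n D k < aboveCount (h + k) y} ∪
          {y | 5 ≤ overflow (h + k) y ∧ (aboveCount (h + k) y : ℝ) ≤ 5 * l}) := by
        refine prob_mono t x ?_
        rintro y ⟨i, hi⟩ hy
        rcases lt_or_ge (layerBound n D k) (aboveCount (h + k) y) with h1 | h1
        · exact Or.inl h1
        refine Or.inr ⟨?_, h1.trans hbk⟩
        by_contra h2
        have hy' : ∑ i, (y i : ℝ) = ∑ i, (x i : ℝ) + t := by exact_mod_cast hy
        have h3 : y i ≤ h + k + 4 := (le_add_overflow (h + k) y i).trans (by omega)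
        have h4 : (y i : ℝ) ≤ h + k + 4 := by exact_mod_cast h3
        rw [excess, hy'] at hi
        linarith
    _ ≤ (1 / (n : ℝ) ^ 4 + k * (1 / (n : ℝ) ^ 5)) + 1 / (n : ℝ) ^ 4 :=
        (prob_union_le t x _ _).trans (add_le_add hlayers (hlast.trans hlast'))
    _ ≤ (1 / (n : ℝ) ^ 4 + n * (1 / (n : ℝ) ^ 5)) + 1 / (n : ℝ) ^ 4 := by gcongr
    _ = _ := by field_simp; norm_num

/-! ### The gap of the process started with empty bins -/

lemma prob_gap_le_of_large [NeZero n] (m : ℕ) (hlog : Real.exp 1 ≤ Real.log n)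
    (hbig : 10 ^ 22 * Real.log n ^ 15 ≤ n) :
    prob m (0 : Fin n → ℕ) {y | ∃ i, 344 * Real.log (Real.log n) < excess y i} ≤
      1 / (n : ℝ) ^ 3 := by
  set l := Real.log n with hl
  have hl1 : 1 ≤ l := by linarith [Real.exp_one_gt_d9]
  have hn5 : (5 : ℝ) ≤ n := by
    have : 1 ≤ l ^ 15 := one_le_pow₀ hl1
    linarith
  have hn0 : (0 : ℝ) < n := by linarith
  have hexpl : Real.exp l = n := Real.exp_log hn0
  have hexp5 : Real.exp (-(5 * l)) = 1 / (n : ℝ) ^ 5 := by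
    rw [Real.exp_neg, ← hexpl, ← Real.exp_nat_mul, one_div]; norm_num
  -- in `n * L` steps the potential contracts by a factor `exp (-L / 192) ≤ n ^ (-5)`
  set L := ⌈1000 * l⌉₊ with hL
  have hL1 : 1000 * l ≤ L := Nat.le_ceil _
  have hL2 : (L : ℝ) ≤ 1001 * l := by
    have : (L : ℝ) < 1000 * l + 1 := Nat.ceil_lt_add_one (by positivity)
    linarith
  have hL0 : 0 < L := Nat.ceil_pos.2 (by positivity)
  have h34 : 3 / (n : ℝ) ^ 4 + 2 / (n : ℝ) ^ 4 ≤ 1 / (n : ℝ) ^ 3 := by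
    rw [← add_div, div_le_div_iff₀ (by positivity) (by positivity)]
    calc (3 + 2) * (n : ℝ) ^ 3 ≤ n * (n : ℝ) ^ 3 := by gcongr; linarith
      _ = _ := by ring
  rcases le_total m (n * L) with hm | hm
  · refine (prob_gap_le_of_start hlog hbig hL0 hL2 hm 0 (fun i => ?_)
      (iterate_transition_potential_zero_le m)).trans ?_
    · simp only [Pi.zero_apply, Nat.cast_zero, Finset.sum_const_zero, zero_add]
      positivity
    · have : 0 ≤ 2 / (n : ℝ) ^ 4 := by positivity
      linarith
  · obtain ⟨s, rfl⟩ := Nat.exists_eq_add_of_le' hm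
    set G : Set (Fin n → ℕ) := {y | potential y ≤ 2 * (n : ℝ) ^ 5} with hG
    have hGc : prob s (0 : Fin n → ℕ) Gᶜ ≤ 2 / (n : ℝ) ^ 4 := by
      calc prob s (0 : Fin n → ℕ) Gᶜ
          ≤ transition^[s] (fun y => 1 / (2 * (n : ℝ) ^ 5) * potential y) 0 := by
            refine prob_le_iterate_transition s 0 _ (fun y => ?_) fun y hy _ => ?_
            · have := le_potential y
              have : 0 ≤ potential y := by linarith
              positivity
            · have hy' : 2 * (n : ℝ) ^ 5 < potential y := not_le.1 hy
              rw [one_div, ← div_eq_inv_mul, one_le_div (by positivity)]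
              exact hy'.le
        _ ≤ 1 / (2 * (n : ℝ) ^ 5) * (3 * n) := by
            rw [iterate_transition_const_mul]
            gcongr
            exact iterate_transition_potential_zero_le s
        _ = (3 / 2) / (n : ℝ) ^ 4 := by field_simp
        _ ≤ _ := by gcongr; norm_num
    refine (prob_add_le s (n * L) 0 _ G (ε := 3 / (n : ℝ) ^ 4) (by positivity)
      fun y hy _ => ?_).trans (by linarith)
    have hyG : potential y ≤ 2 * (n : ℝ) ^ 5 := hy
    refine prob_gap_le_of_start hlog hbig hL0 hL2 le_rfl y (fun i => ?_) ?_
    · -- a bin with excess above `L` alone would make the potential too large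
      have h1 : Real.exp (excess y i / 24) ≤ Real.exp (7 * l) := by
        calc Real.exp (excess y i / 24) ≤ 2 * (2 * (n : ℝ) ^ 5) :=
              (exp_excess_le y i).trans (by gcongr)
          _ = 2 ^ 2 * (n : ℝ) ^ 5 := by ring
          _ ≤ (n : ℝ) ^ 2 * (n : ℝ) ^ 5 := by gcongr; linarith
          _ = (n : ℝ) ^ 7 := by ring
          _ = Real.exp (7 * l) := by rw [← hexpl, ← Real.exp_nat_mul]; norm_num
      have h2 := Real.exp_le_exp.1 h1
      have h3 : ((∑ i, (y i : ℝ)) + ((n * L : ℕ) : ℝ)) / n = (∑ i, (y i : ℝ)) / n + L := by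
        push_cast
        field_simp
      rw [h3]
      rw [excess] at h2
      linarith
    · refine (iterate_transition_potential_le (n * L) y).trans ?_
      have h1 : (1 - 1 / (192 * (n : ℝ))) ^ (n * L) ≤ 1 / (n : ℝ) ^ 5 := by
        have h0 : 0 ≤ 1 - 1 / (192 * (n : ℝ)) := by
          rw [sub_nonneg, div_le_one (by positivity)]; linarith
        calc (1 - 1 / (192 * (n : ℝ))) ^ (n * L)
            ≤ Real.exp (-(1 / (192 * (n : ℝ)))) ^ (n * L) :=
              pow_le_pow_left₀ h0 (Real.one_sub_le_exp_neg _) _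
          _ = Real.exp (-(L / 192)) := by
              rw [← Real.exp_nat_mul]
              push_cast
              congr 1
              field_simp
          _ ≤ Real.exp (-(5 * l)) := Real.exp_le_exp.2 (by linarith)
          _ = _ := hexp5
      have h2 : (1 - 1 / (192 * (n : ℝ))) ^ (n * L) * potential y ≤ 2 := by
        have h3 := le_potential y
        calc (1 - 1 / (192 * (n : ℝ))) ^ (n * L) * potential y
            ≤ 1 / (n : ℝ) ^ 5 * (2 * (n : ℝ) ^ 5) :=
              mul_le_mul h1 hyG (by linarith) (by positivity)
          _ = 2 := by field_simp
      linarith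

lemma exists_forall_log_pow_le :
    ∃ N : ℕ, 3 ≤ N ∧ ∀ n : ℕ, N ≤ n →
      Real.exp 1 ≤ Real.log n ∧ 10 ^ 22 * Real.log n ^ 15 ≤ n := by
  have hlog : Filter.Tendsto (fun n : ℕ => Real.log n) Filter.atTop Filter.atTop :=
    Real.tendsto_log_atTop.comp tendsto_natCast_atTop_atTop
  have h1 := hlog.eventually_ge_atTop (Real.exp 1)
  have h2 := hlog.eventually
    ((Real.tendsto_pow_mul_exp_neg_atTop_nhds_zero 15).eventually_le_const
      (show (0 : ℝ) < 1 / 10 ^ 22 by positivity))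
  obtain ⟨N, hN⟩ := Filter.eventually_atTop.1 (h1.and (h2.and (Filter.eventually_ge_atTop 3)))
  refine ⟨max N 3, le_max_right _ _, fun n hn => ?_⟩
  obtain ⟨h3, h4, h5⟩ := hN n ((le_max_left _ _).trans hn)
  refine ⟨h3, ?_⟩
  have hn0 : (0 : ℝ) < n := by positivity
  rw [Real.exp_neg, Real.exp_log hn0, ← div_eq_mul_inv, div_le_div_iff₀ hn0 (by positivity)] at h4
  linarith

/-- Reduction of the gap bound to a bound on the probability of a large excess. -/
lemma one_sub_le_loadLaw_gap [NeZero n] {m : ℕ} {c ε : ℝ}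
    (h : prob m (0 : Fin n → ℕ) {y | ∃ i, c < excess y i} ≤ ε) :
    1 - ε ≤ (loadLaw n m).toMeasure.real {x : Fin n → ℕ | gap m x ≤ c} := by
  rw [loadLaw_real_apply, ← prob]
  have h1 := prob_compl m (0 : Fin n → ℕ) {x : Fin n → ℕ | gap m x ≤ c}
  have h2 : prob m (0 : Fin n → ℕ) {x : Fin n → ℕ | gap m x ≤ c}ᶜ ≤ ε := by
    refine (prob_mono m 0 fun y hy hsum => ?_).trans h
    have hy' : c < gap m y := not_le.1 hy
    obtain ⟨i, -, hi⟩ := Finset.exists_mem_eq_sup Finset.univ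
      ⟨⟨0, Nat.pos_of_ne_zero (NeZero.ne n)⟩, Finset.mem_univ _⟩ y
    have hsum' : ∑ j, (y j : ℝ) = m := by
      have : ∑ j, y j = m := by simpa using hsum
      exact_mod_cast this
    refine ⟨i, ?_⟩
    rw [gap, hi] at hy'
    rw [excess, hsum']
    exact hy'
  linarith

end

end TwoChoice

theorem mainTheorem6 :
    ∃ C : ℝ, 0 < C ∧
      ∀ (n : ℕ) [NeZero n], 3 ≤ n → ∀ m : ℕ, 1 ≤ m →
        1 - ((n : ℝ) ^ 3)⁻¹ ≤
          (TwoChoice.loadLaw n m).toMeasure.real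
            {x : Fin n → ℕ | TwoChoice.gap m x ≤ C * Real.log (Real.log (n : ℝ))} := by
  obtain ⟨N, hN3, hN⟩ := TwoChoice.exists_forall_log_pow_le
  have hlog3 : 1 < Real.log 3 := by
    rw [Real.lt_log_iff_exp_lt (by norm_num)]
    linarith [Real.exp_one_lt_d9]
  have hll3 : 0 < Real.log (Real.log 3) := Real.log_pos hlog3
  -- the second term makes the bound suffice for the finitely many `n < N`
  set C : ℝ := max 344 (24 * Real.log (6 * (N : ℝ) ^ 4) / Real.log (Real.log 3)) with hC
  refine ⟨C, lt_of_lt_of_le (by norm_num) (le_max_left _ _), ?_⟩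
  intro n _ hn m _
  have hn0 : (0 : ℝ) < n := by positivity
  have hn3 : (3 : ℝ) ≤ n := by exact_mod_cast hn
  have hll : Real.log (Real.log 3) ≤ Real.log (Real.log n) :=
    Real.log_le_log (by linarith) (Real.log_le_log (by norm_num) hn3)
  refine TwoChoice.one_sub_le_loadLaw_gap ?_
  rw [← one_div]
  rcases le_total N n with h | h
  · obtain ⟨h1, h2⟩ := hN n h
    refine le_trans (TwoChoice.prob_mono m 0 ?_) (TwoChoice.prob_gap_le_of_large m h1 h2)
    rintro y ⟨i, hi⟩ -
    refine ⟨i, lt_of_le_of_lt ?_ hi⟩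
    gcongr
    · linarith
    · exact le_max_left _ _
  · refine (TwoChoice.prob_excess_le m _).trans ?_
    have hN0 : (0 : ℝ) < N := by
      have : (n : ℝ) ≤ N := by exact_mod_cast h
      linarith
    have hA : 24 * Real.log (6 * (N : ℝ) ^ 4) ≤ C * Real.log (Real.log n) := by
      calc 24 * Real.log (6 * (N : ℝ) ^ 4)
          = 24 * Real.log (6 * (N : ℝ) ^ 4) / Real.log (Real.log 3) * Real.log (Real.log 3) := by
            field_simp
        _ ≤ C * Real.log (Real.log n) := by
            gcongr
            exact le_max_right _ _
    calc 6 * n * Real.exp (-(C * Real.log (Real.log n)) / 24)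
        ≤ 6 * n * Real.exp (-Real.log (6 * (N : ℝ) ^ 4)) := by
          gcongr
          linarith
      _ = 6 * n * (6 * (N : ℝ) ^ 4)⁻¹ := by
          rw [Real.exp_neg, Real.exp_log (by positivity)]
      _ ≤ 6 * n * (6 * (n : ℝ) ^ 4)⁻¹ := by gcongr
      _ = 1 / (n : ℝ) ^ 3 := by field_simp
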